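/- Let $R$ be a small preadditive category (for instance a ring, regarded as a preadditive category with one object), and let $\mathrm{Mod}\text{-}R$ be the category of right $R$-modules, that is, of additive functors $M : R^{\mathrm{op}} \to \mathbf{Ab}$. The elements of $M$ of sort $r$, for an object $r$ of $R$, are the elements of $M(r)$; all tuples are finite and each entry has a specified sort. A pp formula $\phi(\overline{x})$ is a formula $\exists \overline{y}\, \bigwedge_{j=1}^m \sum_{i=1}^n x_i r_{ij} + \sum_{k=1}^t y_k s_{kj} = 0$ whose coefficients $r_{ij}, s_{kj}$ are morphisms of $R$ (of matching sorts); $\phi(M)$ denotes its solution set in the module $M$. A pp-pair is a pair $(\phi,\psi)$ of pp formulas in the same free variables with $\psi(M) \subseteq \phi(M)$ for every module $M$. A definable subcategory of $\mathrm{Mod}\text{-}R$ is a full subcategory whose objects are exactly the modules $M$ with $\phi(M)=\psi(M)$ for all $(\phi,\psi)$ in some set $\Phi$ of pp-pairs. For a tuple $\overline{a}$ from $M$ put $\mathrm{pp}^M(\overline{a}) = \{\psi \text{ pp} : \overline{a}\in\psi(M)\}$. A monomorphism $i: K \to N$ of modules is pure if $\mathrm{pp}^N(i\overline{a}) = \mathrm{pp}^K(\overline{a})$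 for every tuple $\overline{a}$ from $K$; a pure epimorphism is an epimorphism of modules whose kernel is a pure submodule. Let $\mathcal{D}$ be a definable subcategory of $\mathrm{Mod}\text{-}R$. For a pp formula $\phi$ let $\langle\phi\rangle_{\mathcal{D}}$ be the set of pp formulas $\psi$, in the same free variables, such that $\phi(D)\subseteq\psi(D)$ for every $D\in\mathcal{D}$; say that the pp-type $\mathrm{pp}^M(\overline{a})$ is $\mathcal{D}$-generated by $\phi$ if it equals $\langle\phi\rangle_{\mathcal{D}}$. A module $M\in\mathcal{D}$ is strictly $\mathcal{D}$-atomic if (i) for every tuple $\overline{a}$ from $M$, the pp-type $\mathrm{pp}^M(\overline{a})$ is $\mathcal{D}$-generated by some pp formula, and (ii) for every tuple $\overline{a}$ from $M$, every pp formula $\phi$ which $\mathcal{D}$-generates $\mathrm{pp}^M(\overline{a})$, every $D\in\mathcal{D}$ and every $\overline{b}\in\phi(D)$, there is a morphism $f: M\to D$ with $f\overline{a}=\overline{b}$. A module $M\in\mathcal{D}$ is locally $\mathcal{D}$-pure-projective if every pure epimorphism $f: D\to M$ with $D\in\mathcal{D}$ is locally split, that is, for every tuple $\overline{a}$ from $M$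 there is a morphism $g: M\to D$ with $fg\,\overline{a}=\overline{a}$. Then, for every $M\in\mathcal{D}$: $M$ is strictly $\mathcal{D}$-atomic if and only if $M$ is locally $\mathcal{D}$-pure-projective. -/

import Mathlib

open CategoryTheory Opposite

universe w v u

namespace AtomicModules

/-- Right modules over a small preadditive category `R` (a ring with many objects): additive
functors from `Rᵒᵖ` to abelian groups. If `R` has one object, they are the right modules over the
ring of endomorphisms of that object. -/
abbrev RightMod (R : Type u) [Category.{v} R] [Preadditive R] :=
  Rᵒᵖ ⥤+ AddCommGrpCat.{max u v w}

variable {R : Type u} [Category.{v} R] [Preadditive R]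

/-- The group of elements of sort `r` of the module `M`. For an ordinary ring there is one sort. -/
abbrev Elt (M : RightMod.{w} R) (r : R) : Type (max u v w) := M.obj.obj (op r)

/-- The scalar multiple `a · ρ`, an element of sort `r`, of `a`, of sort `s`, by `ρ : r ⟶ s`. -/
def act (M : RightMod.{w} R) {r s : R} (a : Elt M s) (ρ : r ⟶ s) : Elt M r :=
  (M.obj.map ρ.op).hom a

/-- The effect of a morphism of modules on elements of sort `r`. -/
def mapElt {M N : RightMod.{w} R} (f : M ⟶ N) {r : R} (a : Elt M r) : Elt N r :=
  (f.hom.app (op r)).hom a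

/-- Finite tuples from `M` whose entries have the prescribed sorts. -/
abbrev Tuple (M : RightMod.{w} R) {n : ℕ} (s : Fin n → R) : Type (max u v w) :=
  ∀ i, Elt M (s i)

/-- The effect of a morphism of modules on tuples, entry by entry. -/
def mapTuple {M N : RightMod.{w} R} (f : M ⟶ N) {n : ℕ} {s : Fin n → R} (a : Tuple M s) :
    Tuple N s :=
  fun i => mapElt f (a i)

/-- A pp formula `∃ y, ⋀ j, ∑ i, x i · r i j + ∑ k, y k · t k j = 0` in free variables `x i` of
sort `s i`. The variable `y k` has sort `boundSort k`, and the `j`-th equation is one between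
elements of sort `eqSort j`. -/
structure PPFormula {n : ℕ} (s : Fin n → R) where
  numBound : ℕ
  boundSort : Fin numBound → R
  numEq : ℕ
  eqSort : Fin numEq → R
  freeCoeff : ∀ (i : Fin n) (j : Fin numEq), eqSort j ⟶ s i
  boundCoeff : ∀ (k : Fin numBound) (j : Fin numEq), eqSort j ⟶ boundSort k

/-- The solution set `φ(M)` of a pp formula in a module. -/
def PPFormula.sol {n : ℕ} {s : Fin n → R} (φ : PPFormula s) (M : RightMod.{w} R) :
    Set (Tuple M s) :=
  {a | ∃ b : Tuple M φ.boundSort, ∀ j,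
    ∑ i, act M (a i) (φ.freeCoeff i j) + ∑ k, act M (b k) (φ.boundCoeff k j) = 0}

/-- The preorder `φ ≤_D ψ` of pp formulas modulo a class `D` of modules. -/
def PPLe (D : ObjectProperty (RightMod.{w} R)) {n : ℕ} {s : Fin n → R} (φ ψ : PPFormula s) :
    Prop :=
  ∀ M : RightMod.{w} R, D M → φ.sol M ⊆ ψ.sol M

/-- A pp-pair `upper / lower`: two pp formulas in the same free variables with
`lower(M) ≤ upper(M)` for every module `M`. -/
structure PPPair (R : Type u) [Category.{v} R] [Preadditive R] where
  arity : ℕ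
  sort : Fin arity → R
  upper : PPFormula sort
  lower : PPFormula sort
  le : PPLe.{w} ⊤ lower upper

/-- A pp-pair is closed on `M` if its two formulas have the same solutions in `M`. -/
def PPPair.ClosedOn (p : PPPair.{w} R) (M : RightMod.{w} R) : Prop :=
  p.upper.sol M = p.lower.sol M

/-- A definable subcategory: the full subcategory of the modules on which all the pp-pairs in some
set are closed. -/
def IsDefinable (D : ObjectProperty (RightMod.{w} R)) : Prop :=
  ∃ Φ : Set (PPPair.{w} R), ∀ M, D M ↔ ∀ p ∈ Φ, p.ClosedOn M

/-- The pp-type of a tuple in `M`. -/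
def ppType (M : RightMod.{w} R) {n : ℕ} {s : Fin n → R} (a : Tuple M s) : Set (PPFormula s) :=
  {φ | a ∈ φ.sol M}

/-- The pp-type `⟨φ⟩_D` generated by `φ` modulo `D`. -/
def ppGenerated (D : ObjectProperty (RightMod.{w} R)) {n : ℕ} {s : Fin n → R} (φ : PPFormula s) :
    Set (PPFormula s) :=
  {ψ | PPLe D φ ψ}

/-- `M` is `D`-atomic: the pp-type of every finite tuple from `M` is `D`-generated by a single pp
formula. -/
def IsAtomic (D : ObjectProperty (RightMod.{w} R)) (M : RightMod.{w} R) : Prop :=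
  ∀ (n : ℕ) (s : Fin n → R) (a : Tuple M s), ∃ φ : PPFormula s, ppType M a = ppGenerated D φ

/-- `M` is strictly `D`-atomic: it is `D`-atomic and, whenever the pp-type of a tuple `a` from `M`
is `D`-generated by `φ`, every solution of `φ` in a member of `D` is the image of `a` under some
morphism. -/
def IsStrictlyAtomic (D : ObjectProperty (RightMod.{w} R)) (M : RightMod.{w} R) : Prop :=
  IsAtomic D M ∧
    ∀ (n : ℕ) (s : Fin n → R) (a : Tuple M s) (φ : PPFormula s), ppType M a = ppGenerated D φ →
      ∀ N : RightMod.{w} R, D N → ∀ b ∈ φ.sol N, ∃ f : M ⟶ N, mapTuple f a = b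

/-- A pure monomorphism: a morphism that preserves and reflects all pp formulas. It is injective,
by the case of the formula `x = 0`. -/
def IsPureMono {M N : RightMod.{w} R} (f : M ⟶ N) : Prop :=
  ∀ (n : ℕ) (s : Fin n → R) (a : Tuple M s), ppType N (mapTuple f a) = ppType M a

/-- A pure epimorphism: a morphism `f` that is surjective (on each sort) and whose kernel is a pure
submodule, that is, the last map of a pure-exact sequence `0 → K → N → M → 0`. -/
def IsPureEpi {N M : RightMod.{w} R} (f : N ⟶ M) : Prop :=
  (∀ r : R, Function.Surjective fun b : Elt N r => mapElt f b) ∧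
    ∃ (K : RightMod.{w} R) (i : K ⟶ N), IsPureMono i ∧
      ∀ (r : R) (b : Elt N r), mapElt f b = 0 ↔ ∃ c : Elt K r, mapElt i c = b

/-- `f : N ⟶ M` is locally split: every finite tuple `a` from `M` has a local section, a morphism
`g : M ⟶ N` with `f (g a) = a`. -/
def IsLocallySplit {N M : RightMod.{w} R} (f : N ⟶ M) : Prop :=
  ∀ (n : ℕ) (s : Fin n → R) (a : Tuple M s), ∃ g : M ⟶ N, mapTuple f (mapTuple g a) = a

/-- `M` is locally `D`-pure-projective: every pure epimorphism onto `M` from a member of `D` is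
locally split. -/
def IsLocallyPureProjective (D : ObjectProperty (RightMod.{w} R)) (M : RightMod.{w} R) : Prop :=
  ∀ N : RightMod.{w} R, D N → ∀ f : N ⟶ M, IsPureEpi f → IsLocallySplit f

end AtomicModules

/-! From strictly atomic to locally pure-projective: solutions of pp formulas lift along pure
epimorphisms (`IsPureEpi.exists_mem_sol`). If `φ` generates the pp-type of `a`, lift `a` to a
solution of `φ` in the covering module; strict atomicity supplies a morphism sending `a` there,
which is the local section.

Conversely, cover `M` by a pure epimorphism from a cellular member of `D`
(`exists_cellular_pureEpi`). A local section at `a` sends `a` to a tuple of the cover that is linear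
in a solution of a finite system, and that solution can be mapped to any solution in any member of
`D`. The pp formula describing such linear combinations (`exists_ppFormula`) therefore holds of `a`
and has every solution realised by a morphism from `M`; so it generates the pp-type of `a`.

The cover is built in two stages. Adjoining to zero a generic solution for each solution in `M` of
each finite homogeneous system makes the kernel pure. Then, to land in `D`, witnesses for the lower
formula of each defining pair are adjoined to all solutions of the upper one, `ω` times
(`exists_cellular_weak_reflection`). Members of `D` already contain such witnesses, so morphisms to
them extend, though not uniquely; cellularity survives because each element involves finitely many
witnesses (`exists_cellular_extension`). -/

namespace AtomicModules

variable {R : Type u} [Category.{v} R] [Preadditive R]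

/-! ### Scalar action and morphisms on elements. -/

section Basic

variable {M N P : RightMod.{w} R}

@[simp] lemma act_id {r : R} (a : Elt M r) : act M a (𝟙 r) = a := by
  simp [act]

lemma act_act {q r s : R} (a : Elt M s) (ρ : r ⟶ s) (σ : q ⟶ r) :
    act M (act M a ρ) σ = act M a (σ ≫ ρ) := by
  simp [act]

/-- The action of the coefficients, as a biadditive map. -/
def actHom (M : RightMod.{w} R) (r s : R) : (r ⟶ s) →+ Elt M s →+ Elt M r :=
  AddMonoidHom.mk' (fun ρ => (M.obj.map ρ.op).hom) fun ρ σ => by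
    rw [op_add, Functor.map_add]; rfl

lemma actHom_apply {r s : R} (ρ : r ⟶ s) (a : Elt M s) : actHom M r s ρ a = act M a ρ := rfl

@[simp] lemma act_zero {r s : R} (ρ : r ⟶ s) : act M 0 ρ = 0 :=
  map_zero (actHom M r s ρ)

lemma act_add {r s : R} (a b : Elt M s) (ρ : r ⟶ s) : act M (a + b) ρ = act M a ρ + act M b ρ :=
  map_add (actHom M r s ρ) a b

lemma act_sub {r s : R} (a b : Elt M s) (ρ : r ⟶ s) : act M (a - b) ρ = act M a ρ - act M b ρ :=
  map_sub (actHom M r s ρ) a b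

lemma act_sum {ι : Type*} (t : Finset ι) {r s : R} (a : ι → Elt M s) (ρ : r ⟶ s) :
    act M (∑ i ∈ t, a i) ρ = ∑ i ∈ t, act M (a i) ρ :=
  map_sum (actHom M r s ρ) a t

@[simp] lemma act_hom_zero {r s : R} (a : Elt M s) : act M a (0 : r ⟶ s) = 0 := by
  simp [← actHom_apply]

lemma act_hom_add {r s : R} (a : Elt M s) (ρ σ : r ⟶ s) :
    act M a (ρ + σ) = act M a ρ + act M a σ := by
  simp [← actHom_apply]

lemma act_hom_neg {r s : R} (a : Elt M s) (ρ : r ⟶ s) : act M a (-ρ) = -act M a ρ := by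
  simp [← actHom_apply]

lemma act_hom_sum {ι : Type*} (t : Finset ι) {r s : R} (a : Elt M s) (ρ : ι → (r ⟶ s)) :
    act M a (∑ i ∈ t, ρ i) = ∑ i ∈ t, act M a (ρ i) := by
  simp [← actHom_apply]

/-- The effect of a morphism on the elements of a sort, as an additive map. -/
def mapHom (f : M ⟶ N) (r : R) : Elt M r →+ Elt N r := (f.hom.app (op r)).hom

@[simp] lemma mapElt_zero (f : M ⟶ N) {r : R} : mapElt f (0 : Elt M r) = 0 :=
  map_zero (mapHom f r)

lemma mapElt_add (f : M ⟶ N) {r : R} (a b : Elt M r) :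
    mapElt f (a + b) = mapElt f a + mapElt f b :=
  map_add (mapHom f r) a b

lemma mapElt_sub (f : M ⟶ N) {r : R} (a b : Elt M r) :
    mapElt f (a - b) = mapElt f a - mapElt f b :=
  map_sub (mapHom f r) a b

lemma mapElt_sum {ι : Type*} (t : Finset ι) (f : M ⟶ N) {r : R} (a : ι → Elt M r) :
    mapElt f (∑ i ∈ t, a i) = ∑ i ∈ t, mapElt f (a i) :=
  map_sum (mapHom f r) a t

lemma mapElt_act (f : M ⟶ N) {r s : R} (a : Elt M s) (ρ : r ⟶ s) :
    mapElt f (act M a ρ) = act N (mapElt f a) ρ :=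
  ConcreteCategory.congr_hom (f.hom.naturality ρ.op) a

@[simp] lemma mapElt_comp (f : M ⟶ N) (g : N ⟶ P) {r : R} (a : Elt M r) :
    mapElt (f ≫ g) a = mapElt g (mapElt f a) := rfl

lemma mapTuple_comp (f : M ⟶ N) (g : N ⟶ P) {n : ℕ} {s : Fin n → R} (a : Tuple M s) :
    mapTuple (f ≫ g) a = mapTuple g (mapTuple f a) := rfl

lemma PPFormula.mapTuple_mem_sol (f : M ⟶ N) {n : ℕ} {s : Fin n → R} {φ : PPFormula s}
    {a : Tuple M s} (ha : a ∈ φ.sol M) : mapTuple f a ∈ φ.sol N := by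
  obtain ⟨b, hb⟩ := ha
  refine ⟨mapTuple f b, fun j => ?_⟩
  have := congrArg (mapElt f) (hb j)
  rwa [mapElt_add, mapElt_sum, mapElt_sum, mapElt_zero, Finset.sum_congr rfl fun _ _ =>
    mapElt_act f _ _, Finset.sum_congr (s₁ := (Finset.univ : Finset (Fin φ.numBound))) rfl
    fun _ _ => mapElt_act f _ _] at this

end Basic

/-! ### Submodules, quotients and free extensions. -/

section Constructions

/-- The module with prescribed groups of elements and action of the coefficients. -/
def ofAction (A : R → Type (max u v w)) [∀ r, AddCommGroup (A r)]
    (α : ∀ r s, (r ⟶ s) →+ A s →+ A r) (h_id : ∀ r a, α r r (𝟙 r) a = a)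
    (h_comp : ∀ q r s (σ : q ⟶ r) (ρ : r ⟶ s) a, α q s (σ ≫ ρ) a = α q r σ (α r s ρ a)) :
    RightMod.{w} R :=
  { obj :=
      { obj r := AddCommGrpCat.of (A r.unop)
        map ρ := AddCommGrpCat.ofHom (α _ _ ρ.unop)
        map_id r := by ext a; exact h_id _ a
        map_comp ρ σ := by ext a; exact h_comp _ _ _ _ _ a }
    property :=
      { map_add := by
          intro r s ρ σ
          ext a
          exact DFunLike.congr_fun (map_add (α _ _) ρ.unop σ.unop) a } }

/-- The morphism of modules with prescribed components. -/
def homMk {M N : RightMod.{w} R} (f : ∀ r, Elt M r →+ Elt N r)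
    (hf : ∀ r s (ρ : r ⟶ s) a, f r (act M a ρ) = act N (f s a) ρ) : M ⟶ N :=
  ⟨{ app r := AddCommGrpCat.ofHom (f r.unop)
     naturality r s ρ := by ext a; exact hf _ _ ρ.unop a }⟩

lemma hom_ext_elt {M N : RightMod.{w} R} {f g : M ⟶ N}
    (h : ∀ r (a : Elt M r), mapElt f a = mapElt g a) : f = g := by
  apply ObjectProperty.hom_ext
  ext r a
  exact h r.unop a

lemma exists_submodule (M : RightMod.{w} R) (S : ∀ r, AddSubgroup (Elt M r))
    (hS : ∀ r s (ρ : r ⟶ s), ∀ a ∈ S s, act M a ρ ∈ S r) :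
    ∃ (K : RightMod.{w} R) (i : K ⟶ M), (∀ r, Function.Injective fun c : Elt K r => mapElt i c) ∧
      ∀ r (a : Elt M r), a ∈ S r ↔ ∃ c : Elt K r, mapElt i c = a := by
  let α : ∀ r s, (r ⟶ s) →+ S s →+ S r := fun r s =>
    AddMonoidHom.mk' (fun ρ => ((actHom M r s ρ).comp (S s).subtype).codRestrict (S r)
      fun a => hS r s ρ _ a.2) fun ρ σ => by
        ext a
        exact act_hom_add _ _ _
  let K : RightMod.{w} R := ofAction (fun r => S r) α
    (fun r a => Subtype.ext (act_id _)) (fun q r s σ ρ a => Subtype.ext (act_act _ _ _).symm)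
  refine ⟨K, homMk (fun r => (S r).subtype) fun _ _ _ _ => rfl,
    fun r => Subtype.val_injective, fun r a => ⟨fun h => ⟨⟨a, h⟩, rfl⟩, ?_⟩⟩
  rintro ⟨c, rfl⟩
  exact c.2

/-- Uniqueness of the factorisation is left out: only extensions of morphisms are ever needed. -/
lemma exists_quotient (M : RightMod.{w} R) {E : Type*} (sort : E → R)
    (rel : ∀ e, Elt M (sort e)) :
    ∃ (Q : RightMod.{w} R) (π : M ⟶ Q), (∀ r, Function.Surjective fun a : Elt M r => mapElt π a) ∧
      (∀ e, mapElt π (rel e) = 0) ∧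
      ∀ (X : RightMod.{w} R) (f : M ⟶ X), (∀ e, mapElt f (rel e) = 0) → ∃ g : Q ⟶ X, π ≫ g = f := by
  let S : ∀ r, AddSubgroup (Elt M r) := fun r =>
    AddSubgroup.closure {a | ∃ e, ∃ ρ : r ⟶ sort e, a = act M (rel e) ρ}
  have hS : ∀ r s (ρ : r ⟶ s), S s ≤ (S r).comap (actHom M r s ρ) := by
    intro r s ρ
    rw [AddSubgroup.closure_le]
    rintro _ ⟨e, σ, rfl⟩
    exact AddSubgroup.subset_closure ⟨e, ρ ≫ σ, act_act _ _ _⟩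
  let α : ∀ r s, (r ⟶ s) →+ (Elt M s ⧸ S s) →+ (Elt M r ⧸ S r) := fun r s =>
    AddMonoidHom.mk' (fun ρ => QuotientAddGroup.map _ _ (actHom M r s ρ) (hS r s ρ))
      fun ρ σ => by
        ext a
        exact congrArg (QuotientAddGroup.mk' (S r)) (act_hom_add a ρ σ)
  let Q : RightMod.{w} R := ofAction (fun r => Elt M r ⧸ S r) α
    (by
      intro r a
      induction a using QuotientAddGroup.induction_on with
      | H a => exact congrArg (QuotientAddGroup.mk' (S r)) (act_id a))
    (by
      intro q r s σ ρ a
      induction a using QuotientAddGroup.induction_on with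
      | H a => exact congrArg (QuotientAddGroup.mk' (S q)) (act_act a ρ σ).symm)
  refine ⟨Q, homMk (fun r => QuotientAddGroup.mk' (S r)) fun _ _ _ _ => rfl,
    fun r => QuotientAddGroup.mk'_surjective _, fun e => ?_, fun X f hf => ?_⟩
  · exact (QuotientAddGroup.eq_zero_iff _).2
      (AddSubgroup.subset_closure ⟨e, 𝟙 _, (act_id _).symm⟩)
  · have hker : ∀ r, S r ≤ (mapHom f r).ker := by
      intro r
      rw [AddSubgroup.closure_le]
      rintro _ ⟨e, ρ, rfl⟩
      change mapElt f _ = 0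
      rw [mapElt_act, hf, act_zero]
    refine ⟨homMk (M := Q) (fun r => QuotientAddGroup.lift (S r) (mapHom f r) (hker r)) ?_, ?_⟩
    · intro r s ρ a
      induction a using QuotientAddGroup.induction_on with
      | H a => exact mapElt_act f a ρ
    · exact hom_ext_elt fun r a => rfl

open Classical in
/-- Generators freely adjoined to a module. -/
lemma exists_free_extension (N : RightMod.{w} R) {Y : Type (max u v w)} (sort : Y → R) :
    ∃ (F : RightMod.{w} R) (ι : N ⟶ F) (y : ∀ k, Elt F (sort k)),
      (∀ r (b : Elt F r), ∃ (n : Elt N r) (S : Finset Y) (h : ∀ k, r ⟶ sort k),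
        b = mapElt ι n + ∑ k ∈ S, act F (y k) (h k)) ∧
      ∀ (X : RightMod.{w} R) (f : N ⟶ X) (z : ∀ k, Elt X (sort k)),
        ∃ g : F ⟶ X, ι ≫ g = f ∧ ∀ k, mapElt g (y k) = z k := by
  -- The direct sum of the representables at the sorts of the generators; each generator is an
  -- identity morphism, and freeness is Yoneda.
  let G : R → Type (max u v w) := fun r => DirectSum Y fun k => (r ⟶ sort k)
  let pre : ∀ r s, (r ⟶ s) →+ G s →+ G r := fun r s =>
    AddMonoidHom.mk' (fun ρ => DirectSum.map fun k => Preadditive.leftComp (sort k) ρ)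
      fun ρ σ => by
        refine DirectSum.addHom_ext fun k h => ?_
        simp [DirectSum.map_of, Preadditive.leftComp]
  let o : ∀ r k, (r ⟶ sort k) →+ G r := fun r k => DirectSum.of (fun k => (r ⟶ sort k)) k
  have pre_of : ∀ r s (ρ : r ⟶ s) k (h : s ⟶ sort k),
      pre r s ρ (o s k h) = o r k (ρ ≫ h) := fun r s ρ k h =>
    DirectSum.map_of _ _ _
  let α : ∀ r s, (r ⟶ s) →+ (Elt N s × G s) →+ (Elt N r × G r) := fun r s =>
    AddMonoidHom.mk' (fun ρ => (actHom N r s ρ).prodMap (pre r s ρ)) fun ρ σ => by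
      ext a <;> simp
  let F : RightMod.{w} R := ofAction (fun r => Elt N r × G r) α
    (by
      rintro r ⟨n, b⟩
      refine Prod.ext (act_id n) ?_
      change pre r r (𝟙 r) b = AddMonoidHom.id _ b
      congr 1
      refine DirectSum.addHom_ext fun k h => ?_
      exact (pre_of _ _ _ _ _).trans (by rw [Category.id_comp]; rfl))
    (by
      rintro q r s σ ρ ⟨n, b⟩
      refine Prod.ext (act_act n ρ σ).symm ?_
      change pre q s (σ ≫ ρ) b = ((pre q r σ).comp (pre r s ρ)) b
      congr 1
      refine DirectSum.addHom_ext fun k h => ?_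
      change pre q s (σ ≫ ρ) (o s k h) = pre q r σ (pre r s ρ (o s k h))
      rw [pre_of, pre_of, pre_of, Category.assoc])
  let ι : N ⟶ F := homMk (fun r => AddMonoidHom.inl _ _) fun r s ρ a =>
    Prod.ext rfl (map_zero (pre r s ρ)).symm
  let y : ∀ k, Elt F (sort k) := fun k => ((0, o _ k (𝟙 _)) : Elt N _ × G _)
  have y_act : ∀ r k (h : r ⟶ sort k),
      act F (y k) h = ((0, o r k h) : Elt N r × G r) := fun r k h =>
    Prod.ext (act_zero (M := N) h) ((pre_of _ _ _ _ _).trans (by simp))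
  refine ⟨F, ι, y, fun r b => ?_, fun X f z => ?_⟩
  · obtain ⟨n, b⟩ := (b : Elt N r × G r)
    refine ⟨n, DFinsupp.support b, fun k => b k, ?_⟩
    have h : b = ∑ k ∈ DFinsupp.support b, o r k (b k) :=
      (DirectSum.sum_support_of b).symm
    simp only [y_act]
    have h' : ∑ k ∈ DFinsupp.support b, ((0, o r k (b k)) : Elt N r × G r) = (0, b) :=
      (map_sum (AddMonoidHom.inr (Elt N r) (G r)) _ _).symm.trans (congrArg _ h.symm)
    refine Eq.trans ?_ (congrArg (fun c => ((n, 0) : Elt N r × G r) + c) h'.symm)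
    exact Prod.ext (add_zero n).symm (zero_add b).symm
  · let ev : ∀ r, G r →+ Elt X r := fun r =>
      DirectSum.toAddMonoid fun k => (actHom X r (sort k)).flip (z k)
    have ev_of : ∀ r k (h : r ⟶ sort k), ev r (o r k h) = act X (z k) h :=
      fun r k h => DirectSum.toAddMonoid_of _ _ _
    refine ⟨homMk (M := F) (fun r => (mapHom f r).coprod (ev r)) ?_, ?_, fun k => ?_⟩
    · rintro r s ρ ⟨n, b⟩
      have h : (ev r).comp (pre r s ρ) = (actHom X r s ρ).comp (ev s) := by
        refine DirectSum.addHom_ext fun k h => ?_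
        change ev r (pre r s ρ (o s k h)) = act X (ev s (o s k h)) ρ
        rw [pre_of, ev_of, ev_of, act_act]
      change mapElt f (act N n ρ) + ((ev r).comp (pre r s ρ)) b =
        act X (mapElt f n + ev s b) ρ
      rw [h, mapElt_act, act_add]
      rfl
    · refine hom_ext_elt fun r a => ?_
      change mapElt f a + ev r 0 = mapElt f a
      simp
    · change mapElt f 0 + ev _ (o _ k (𝟙 _)) = z k
      rw [ev_of, act_id, mapElt_zero, zero_add]

end Constructions

/-! ### Sequential colimits. -/

open Limits in
/-- Sequential colimits of modules are computed on elements. -/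
lemma exists_sequential_colimit (F : ℕ ⥤ RightMod.{w} R) :
    ∃ (L : RightMod.{w} R) (l : ∀ k, F.obj k ⟶ L),
      (∀ k m (h : k ≤ m), F.map (homOfLE h) ≫ l m = l k) ∧
      (∀ r (b : Elt L r), ∃ k, ∃ a : Elt (F.obj k) r, mapElt (l k) a = b) ∧
      (∀ k r (a : Elt (F.obj k) r), mapElt (l k) a = 0 →
        ∃ m, ∃ h : k ≤ m, mapElt (F.map (homOfLE h)) a = 0) ∧
      ∀ (X : RightMod.{w} R) (g : ∀ k, F.obj k ⟶ X),
        (∀ k, F.map (homOfLE k.le_succ) ≫ g (k + 1) = g k) → ∃ g' : L ⟶ X, ∀ k, l k ≫ g' = g k := by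
  let G : ℕ ⥤ Rᵒᵖ ⥤ AddCommGrpCat.{max u v w} := F ⋙ AdditiveFunctor.forget _ _
  have hc (r : Rᵒᵖ) := isColimitOfPreserves ((evaluation _ AddCommGrpCat).obj r) (colimit.isColimit G)
  have : PreservesFilteredColimitsOfSize.{0, 0} (forget AddCommGrpCat.{max u v w}) :=
    preservesFilteredColimitsOfSize_shrink _
  -- The colimit is taken among all functors, so its additivity has to be checked; it is inherited
  -- along the legs at each sort.
  have hadd : (colimit G).Additive :=
    { map_add := by
        intro r s ρ σ
        refine (hc r).hom_ext fun k => ?_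
        change (colimit.ι G k).app r ≫ _ = (colimit.ι G k).app r ≫ _
        rw [Preadditive.comp_add, ← NatTrans.naturality, ← NatTrans.naturality,
          ← NatTrans.naturality, ← Preadditive.add_comp]
        congr 1
        exact (F.obj k).property.map_add }
  let L : RightMod.{w} R := ⟨colimit G, hadd⟩
  let l : ∀ k, F.obj k ⟶ L := fun k => ⟨colimit.ι G k⟩
  refine ⟨L, l, fun k m h => ?_, fun r b => ?_, fun k r a ha => ?_, fun X g hg => ?_⟩
  · exact ObjectProperty.hom_ext _ (colimit.w G (homOfLE h))
  · exact Concrete.isColimit_exists_rep _ (hc (op r)) b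
  · obtain ⟨m, f, h⟩ := Concrete.isColimit_exists_of_rep_eq _ (hc (op r)) a 0
      (ha.trans (mapElt_zero (l k)).symm)
    obtain ⟨f', h⟩ := h
    refine ⟨m, leOfHom f, ?_⟩
    refine Eq.trans ?_ (h.trans (mapElt_zero (F.map f')))
    rfl
  · let c : Cocone G := ⟨X.obj, NatTrans.ofSequence (fun k => (g k).hom) fun k => by
      have := congrArg (fun f => f.hom) (hg k)
      exact this.trans (Category.comp_id _).symm⟩
    exact ⟨⟨colimit.desc G c⟩, fun k => ObjectProperty.hom_ext _ (colimit.ι_desc c k)⟩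

/-! ### Adjoining witnesses. -/

lemma sum_eq_sum_image_fst {J A : Type*} {κ : J → Type*} [∀ j, Fintype (κ j)] [DecidableEq J]
    [AddCommMonoid A] (S : Finset (Σ j, κ j)) (t : (Σ j, κ j) → A) (ht : ∀ k ∉ S, t k = 0) :
    ∑ k ∈ S, t k = ∑ j ∈ S.image Sigma.fst, ∑ k, t ⟨j, k⟩ := by
  rw [← Finset.sum_sigma]
  exact Finset.sum_subset (fun k hk => by simpa using ⟨k.2, hk⟩) fun k _ hk => ht k hk

/-- Adjoining to a module, for each member of a family of tuples from it, a witness for the truth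
of a given pp formula. -/
lemma exists_adjoin_witnesses (N : RightMod.{w} R) {J : Type (max u v w)} {n : J → ℕ}
    {s : ∀ j, Fin (n j) → R} (ψ : ∀ j, PPFormula (s j)) (a : ∀ j, Tuple N (s j)) :
    ∃ (P : RightMod.{w} R) (ι : N ⟶ P) (y : ∀ j, Tuple P (ψ j).boundSort),
      (∀ j e, ∑ i, act P (mapElt ι (a j i)) ((ψ j).freeCoeff i e) +
        ∑ k, act P (y j k) ((ψ j).boundCoeff k e) = 0) ∧
      (∀ r (b : Elt P r), ∃ (c : Elt N r) (S : Finset J) (h : ∀ j k, r ⟶ (ψ j).boundSort k),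
        (∀ j ∉ S, ∀ k, h j k = 0) ∧
          b = mapElt ι c + ∑ j ∈ S, ∑ k, act P (y j k) (h j k)) ∧
      ∀ (X : RightMod.{w} R) (f : N ⟶ X) (z : ∀ j, Tuple X (ψ j).boundSort),
        (∀ j e, ∑ i, act X (mapElt f (a j i)) ((ψ j).freeCoeff i e) +
          ∑ k, act X (z j k) ((ψ j).boundCoeff k e) = 0) →
        ∃ g : P ⟶ X, ι ≫ g = f ∧ ∀ j k, mapElt g (y j k) = z j k := by
  classical
  obtain ⟨F, ι, y, hgen, huniv⟩ := exists_free_extension N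
    (Y := Σ j, ULift.{max u v w} (Fin (ψ j).numBound)) fun k => (ψ k.1).boundSort k.2.down
  let y' : ∀ j, Tuple F (ψ j).boundSort := fun j k => y ⟨j, ⟨k⟩⟩
  obtain ⟨Q, π, hπ, hrel, hlift⟩ := exists_quotient F
    (E := Σ j, Fin (ψ j).numEq) (fun e => (ψ e.1).eqSort e.2) fun e =>
      ∑ i, act F (mapElt ι (a e.1 i)) ((ψ e.1).freeCoeff i e.2) +
        ∑ k, act F (y' e.1 k) ((ψ e.1).boundCoeff k e.2)
  have map_rel : ∀ (X : RightMod.{w} R) (f : F ⟶ X) j e,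
      mapElt f (∑ i, act F (mapElt ι (a j i)) ((ψ j).freeCoeff i e) +
        ∑ k, act F (y' j k) ((ψ j).boundCoeff k e)) =
      ∑ i, act X (mapElt (ι ≫ f) (a j i)) ((ψ j).freeCoeff i e) +
        ∑ k, act X (mapElt f (y' j k)) ((ψ j).boundCoeff k e) := by
    intro X f j e
    simp only [mapElt_add, mapElt_sum, mapElt_act, mapElt_comp]
  refine ⟨Q, ι ≫ π, fun j k => mapElt π (y' j k), fun j e => ?_, fun r b => ?_,
    fun X f z hz => ?_⟩
  · exact (map_rel Q π j e).symm.trans (hrel ⟨j, e⟩)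
  · obtain ⟨b, rfl⟩ := hπ r b
    obtain ⟨c, S, h, rfl⟩ := hgen r b
    -- Regroup by index `j`, padding with zero coefficients so that whole tuples of witnesses occur.
    refine ⟨c, S.image Sigma.fst, fun j k => if ⟨j, ⟨k⟩⟩ ∈ S then h ⟨j, ⟨k⟩⟩ else 0,
      fun j hj k => if_neg fun hS => hj (Finset.mem_image_of_mem _ hS), ?_⟩
    simp only [mapElt_add, mapElt_sum, mapElt_act, mapElt_comp]
    congr 1
    have hS : ∑ k ∈ S, act Q (mapElt π (y k)) (h k) = ∑ k ∈ S, act Q (mapElt π (y k))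
        (if k ∈ S then h k else 0) := Finset.sum_congr rfl fun k hk => by rw [if_pos hk]
    rw [hS, sum_eq_sum_image_fst S _ fun k hk => by rw [if_neg hk, act_hom_zero]]
    refine Finset.sum_congr rfl fun j _ => ?_
    exact Equiv.ulift.sum_comp fun k =>
      act Q (mapElt π (y ⟨j, ⟨k⟩⟩)) (if ⟨j, ⟨k⟩⟩ ∈ S then h ⟨j, ⟨k⟩⟩ else 0)
  · obtain ⟨g, hg, hgy⟩ := huniv X f fun k => z k.1 k.2.down
    obtain ⟨g', hg'⟩ := hlift X g fun e => by
      refine (map_rel X g e.1 e.2).trans (Eq.trans ?_ (hz e.1 e.2))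
      rw [hg]
      congr 1
      exact Finset.sum_congr rfl fun k _ => by rw [hgy]
    refine ⟨g', by rw [Category.assoc, hg', hg], fun j k => ?_⟩
    rw [← mapElt_comp, hg', hgy]

/-! ### Cellular modules. -/

/-- Relative to a class `D` of modules, every finite family `a` of elements of `N` is given by
linear combinations `h` of a solution `x` of a finite system `c` of linear equations, such that
every solution of the system in a member of `D` is the image of `x` under some morphism. -/
def IsCellular (D : ObjectProperty (RightMod.{w} R)) (N : RightMod.{w} R) : Prop :=
  ∀ (I : Type (max u v w)) [Fintype I] (s : I → R) (a : ∀ i, Elt N (s i)),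
    ∃ (B E : Type (max u v w)) (_ : Fintype B) (_ : Fintype E) (bs : B → R) (es : E → R)
      (c : ∀ k e, es e ⟶ bs k) (h : ∀ k i, s i ⟶ bs k) (x : ∀ k, Elt N (bs k)),
      (∀ e, ∑ k, act N (x k) (c k e) = 0) ∧ (∀ i, a i = ∑ k, act N (x k) (h k i)) ∧
      ∀ X, D X → ∀ z : ∀ k, Elt X (bs k), (∀ e, ∑ k, act X (z k) (c k e) = 0) →
        ∃ g : N ⟶ X, ∀ k, mapElt g (x k) = z k

lemma isCellular_of_forall_eq_zero (D : ObjectProperty (RightMod.{w} R)) (N : RightMod.{w} R)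
    (hN : ∀ r (a : Elt N r), a = 0) : IsCellular D N := fun _ _ _ _ =>
  ⟨PEmpty, PEmpty, inferInstance, inferInstance, PEmpty.elim, PEmpty.elim, fun k => k.elim,
    fun k => k.elim, fun k => k.elim, fun e => e.elim, fun _ => hN _ _, fun _ _ _ _ =>
      ⟨homMk (fun _ => 0) fun _ _ ρ _ => (act_zero ρ).symm, fun k => k.elim⟩⟩

/-- Adjoining witnesses that all members of `D` possess preserves cellularity, and morphisms to the
members of `D` extend. -/
lemma exists_cellular_extension (D : ObjectProperty (RightMod.{w} R)) (N : RightMod.{w} R)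
    (hN : IsCellular D N) {J : Type (max u v w)} {n : J → ℕ}
    {s : ∀ j, Fin (n j) → R} (ψ : ∀ j, PPFormula (s j)) (a : ∀ j, Tuple N (s j))
    (ha : ∀ X, D X → ∀ f : N ⟶ X, ∀ j, mapTuple f (a j) ∈ (ψ j).sol X) :
    ∃ (P : RightMod.{w} R) (ι : N ⟶ P) (y : ∀ j, Tuple P (ψ j).boundSort), IsCellular D P ∧
      (∀ j e, ∑ i, act P (mapElt ι (a j i)) ((ψ j).freeCoeff i e) +
        ∑ k, act P (y j k) ((ψ j).boundCoeff k e) = 0) ∧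
      ∀ (X : RightMod.{w} R) (f : N ⟶ X) (z : ∀ j, Tuple X (ψ j).boundSort),
        (∀ j e, ∑ i, act X (mapElt f (a j i)) ((ψ j).freeCoeff i e) +
          ∑ k, act X (z j k) ((ψ j).boundCoeff k e) = 0) →
        ∃ g : P ⟶ X, ι ≫ g = f ∧ ∀ j k, mapElt g (y j k) = z j k := by
  classical
  obtain ⟨P, ι, y, hrel, hgen, huniv⟩ := exists_adjoin_witnesses N ψ a
  refine ⟨P, ι, y, ?_, hrel, huniv⟩
  intro I _ s' b
  choose b₀ T hb hb0 hbeq using fun i => hgen _ (b i)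
  let S : Finset J := Finset.univ.biUnion T
  have hbS : ∀ i, b i = mapElt ι (b₀ i) + ∑ j : S, ∑ k, act P (y j k) (hb i j k) := by
    intro i
    rw [hbeq i, Finset.sum_coe_sort S fun j => ∑ k, act P (y j k) (hb i j k)]
    congr 1
    refine Finset.sum_subset (Finset.subset_biUnion_of_mem T (Finset.mem_univ i)) fun j _ hj => ?_
    simp [hb0 i j hj]
  -- The family also contains the parameters `a j` for `j ∈ S`, so that the equations of `ψ j` can
  -- be rewritten in terms of `x`.
  obtain ⟨B, E, _, _, bs, es, c, h, x, hx, hbx, hext⟩ := hN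
    (I ⊕ Σ j : S, ULift.{max u v w} (Fin (n j)))
    (Sum.elim s' fun q => s q.1 q.2.down)
    (Sum.rec b₀ fun q => a q.1 q.2.down)
  obtain ⟨h₀, hh₀⟩ : ∃ h₀ : ∀ i k, s' i ⟶ bs k, ∀ i, b₀ i = ∑ k, act N (x k) (h₀ i k) :=
    ⟨_, fun i => hbx (.inl i)⟩
  obtain ⟨h₁, hh₁⟩ : ∃ h₁ : ∀ (j : S) i k, s j i ⟶ bs k,
      ∀ j i, a (j : S) i = ∑ k, act N (x k) (h₁ j i k) :=
    ⟨_, fun j i => hbx (.inr ⟨j, ⟨i⟩⟩)⟩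
  have key : ∀ (X : RightMod.{w} R) (f : N ⟶ X) (j : S) (e : Fin (ψ j).numEq),
      ∑ i, act X (mapElt f (a j i)) ((ψ j).freeCoeff i e) =
        ∑ k, act X (mapElt f (x k)) (∑ i, (ψ j).freeCoeff i e ≫ h₁ j i k) := by
    intro X f j e
    simp only [act_hom_sum, ← act_act]
    rw [Finset.sum_comm]
    refine Finset.sum_congr rfl fun i _ => ?_
    rw [hh₁, mapElt_sum, act_sum]
    simp only [mapElt_act]
  -- The block-diagonal matrix of the bound coefficients: different indices share no witnesses.
  obtain ⟨d, hd, hd'⟩ : ∃ d : ∀ (j : S) (k : Fin (ψ j).numBound) (j' : S) (e : Fin (ψ j').numEq),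
      (ψ j').eqSort e ⟶ (ψ j).boundSort k, (∀ j k e, d j k j e = (ψ j).boundCoeff k e) ∧
        ∀ j k j' e, j ≠ j' → d j k j' e = 0 :=
    ⟨fun j k j' e => if hj : j = j' then by subst hj; exact (ψ j).boundCoeff k e else 0,
      fun j k e => dif_pos rfl, fun j k j' e hj => dif_neg hj⟩
  have sum_d : ∀ (X : RightMod.{w} R) (z : ∀ j : S, Tuple X (ψ j).boundSort) (j : S) e,
      ∑ k : Σ j : S, ULift.{max u v w} (Fin (ψ j).numBound),
        act X (z k.1 k.2.down) (d k.1 k.2.down j e) =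
      ∑ k, act X (z j k) ((ψ j).boundCoeff k e) := by
    intro X z j e
    rw [Fintype.sum_sigma, Finset.sum_eq_single j]
    · exact (Equiv.ulift.sum_comp fun k => act X (z j k) (d j k j e)).trans (by simp only [hd])
    · exact fun j' _ hj => Finset.sum_eq_zero fun k _ => by rw [hd' _ _ _ _ hj, act_hom_zero]
    · exact fun hj => (hj (Finset.mem_univ j)).elim
  -- The old system in `x`, together with the equations of `ψ j` for `j ∈ S` in both `x` and the new
  -- witnesses.
  refine ⟨B ⊕ Σ j : S, ULift.{max u v w} (Fin (ψ j).numBound),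
    E ⊕ Σ j : S, ULift.{max u v w} (Fin (ψ j).numEq), inferInstance, inferInstance,
    Sum.elim bs fun q => (ψ q.1).boundSort q.2.down,
    Sum.elim es fun q => (ψ q.1).eqSort q.2.down,
    Sum.rec
      (fun k => Sum.rec (fun e => c k e) fun e => ∑ i, (ψ e.1).freeCoeff i e.2.down ≫ h₁ e.1 i k)
      (fun k => Sum.rec (fun e => 0) fun e => d k.1 k.2.down e.1 e.2.down),
    Sum.rec (fun k i => h₀ i k) (fun k i => hb i k.1 k.2.down),
    Sum.rec (fun k => mapElt ι (x k)) fun k => y k.1 k.2.down, ?_, fun i => ?_,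
    fun X hX z hz => ?_⟩
  · rintro (e | ⟨j, ⟨e⟩⟩) <;> rw [Fintype.sum_sum_type]
    · have := congrArg (mapElt ι) (hx e)
      simp only [mapElt_sum, mapElt_act, mapElt_zero] at this
      exact (congrArg₂ _ this (Finset.sum_eq_zero fun k _ => act_hom_zero _)).trans (add_zero _)
    · exact (congrArg₂ _ (key P ι j e).symm (sum_d P (fun j => y j) j e)).trans (hrel j e)
  · rw [hbS, Fintype.sum_sum_type, Fintype.sum_sigma, hh₀, mapElt_sum]
    simp only [mapElt_act]
    refine congrArg _ (Finset.sum_congr rfl fun j _ => ?_)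
    exact (Equiv.ulift.sum_comp fun k => act P (y j k) (hb i j k)).symm
  · obtain ⟨f, hf⟩ := hext X hX (fun k => z (.inl k)) fun e => by
      have := hz (.inl e)
      rw [Fintype.sum_sum_type] at this
      refine Eq.trans (Eq.trans (add_zero _).symm (congrArg₂ _ rfl ?_)) this
      exact (Finset.sum_eq_zero fun k _ => act_hom_zero _).symm
    -- Witnesses with index outside `S` are not prescribed by `z`; any that exist in `X` will do.
    choose z₀ hz₀ using ha X hX f
    let z₁ : ∀ j : S, Tuple X (ψ j).boundSort := fun j k => z (.inr ⟨j, ⟨k⟩⟩)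
    obtain ⟨z₂, hz₂, hz₂'⟩ : ∃ z₂ : ∀ j, Tuple X (ψ j).boundSort,
        (∀ j : S, z₂ j = z₁ j) ∧ ∀ j ∉ S, z₂ j = z₀ j :=
      ⟨fun j => if hj : j ∈ S then z₁ ⟨j, hj⟩ else z₀ j, fun j => dif_pos j.2,
        fun j hj => dif_neg hj⟩
    obtain ⟨g, hg, hgy⟩ := huniv X f z₂ fun j e => by
      by_cases hj : j ∈ S
      · have := hz (.inr ⟨⟨j, hj⟩, ⟨e⟩⟩)
        rw [Fintype.sum_sum_type] at this
        rw [key X f ⟨j, hj⟩ e, hz₂ ⟨j, hj⟩]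
        simp only [hf]
        exact (congrArg₂ _ rfl (sum_d X z₁ ⟨j, hj⟩ e).symm).trans this
      · rw [hz₂' j hj]
        exact hz₀ j e
    refine ⟨g, ?_⟩
    rintro (k | ⟨⟨j, hj⟩, ⟨k⟩⟩)
    · exact (congrArg (fun f => mapElt f (x k)) hg).trans (hf k)
    · exact (hgy j k).trans (congrFun (hz₂ ⟨j, hj⟩) k)

/-! ### Weak reflection into a definable subcategory. -/

open Filter in
/-- Every cellular module has a cellular weak reflection in `D`, if `D` is definable. -/
lemma exists_cellular_weak_reflection (D : ObjectProperty (RightMod.{w} R)) (hD : IsDefinable D)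
    (N : RightMod.{w} R) (hN : IsCellular D N) :
    ∃ (L : RightMod.{w} R) (l : N ⟶ L), D L ∧ IsCellular D L ∧
      ∀ X, D X → ∀ f : N ⟶ X, ∃ g : L ⟶ X, l ≫ g = f := by
  obtain ⟨Φ, hΦ⟩ := hD
  have step : ∀ N : {N : RightMod.{w} R // IsCellular D N},
      ∃ (P : {N : RightMod.{w} R // IsCellular D N}) (ι : N.1 ⟶ P.1),
        (∀ p ∈ Φ, ∀ a ∈ p.upper.sol N.1, mapTuple ι a ∈ p.lower.sol P.1) ∧
        ∀ X, D X → ∀ f : N.1 ⟶ X, ∃ g : P.1 ⟶ X, ι ≫ g = f := by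
    rintro ⟨N, hN⟩
    have ha : ∀ X, D X → ∀ f : N ⟶ X, ∀ j : Σ p : Φ, p.1.upper.sol N,
        mapTuple f j.2.1 ∈ j.1.1.lower.sol X := by
      rintro X hX f ⟨p, a, ha⟩
      exact ((hΦ X).1 hX p p.2) ▸ PPFormula.mapTuple_mem_sol f ha
    obtain ⟨P, ι, y, hP, hy, hext⟩ := exists_cellular_extension D N hN
      (J := Σ p : Φ, p.1.upper.sol N) (fun j => j.1.1.lower) (fun j => j.2.1) ha
    refine ⟨⟨P, hP⟩, ι, fun p hp a ha => ⟨_, hy ⟨⟨p, hp⟩, ⟨a, ha⟩⟩⟩, fun X hX f => ?_⟩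
    choose z hz using ha X hX f
    obtain ⟨g, hg, -⟩ := hext X f z hz
    exact ⟨g, hg⟩
  choose P ι hsol hext using step
  obtain ⟨F, η, hcell, hsol, hext, hη⟩ : ∃ (F : ℕ ⥤ RightMod.{w} R) (η : N ⟶ F.obj 0),
      (∀ k, IsCellular D (F.obj k)) ∧
      (∀ k, ∀ p ∈ Φ, ∀ a ∈ p.upper.sol (F.obj k),
        mapTuple (F.map (homOfLE k.le_succ)) a ∈ p.lower.sol (F.obj (k + 1))) ∧
      (∀ k X, D X → ∀ f : F.obj k ⟶ X,
        ∃ g : F.obj (k + 1) ⟶ X, F.map (homOfLE k.le_succ) ≫ g = f) ∧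
      ∀ X (f : N ⟶ X), ∃ g, η ≫ g = f := by
    let C : ℕ → {N : RightMod.{w} R // IsCellular D N} := fun k => Nat.rec ⟨N, hN⟩ (fun _ => P) k
    have hF : ∀ k, (Functor.ofSequence (X := fun k => (C k).1) fun k => ι (C k)).map
        (homOfLE k.le_succ) = ι (C k) := Functor.ofSequence_map_homOfLE_succ _
    refine ⟨Functor.ofSequence (X := fun k => (C k).1) fun k => ι (C k), 𝟙 N, fun k => (C k).2,
      fun k => ?_, fun k => ?_, fun X f => ⟨f, Category.id_comp f⟩⟩
    · rw [hF]
      exact hsol (C k)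
    · rw [hF]
      exact hext (C k)
  obtain ⟨L, l, hl, hrep, hzero, hdesc⟩ := exists_sequential_colimit F
  have extend : ∀ k X, D X → ∀ f : F.obj k ⟶ X, ∃ g : L ⟶ X, l k ≫ g = f := by
    intro k X hX f
    choose e he using fun m (f : F.obj m ⟶ X) => hext m X hX f
    let h : ∀ m, F.obj (k + m) ⟶ X := fun m => Nat.rec f (fun m fm => e (k + m) fm) m
    have hh : ∀ m, F.map (homOfLE (k + m).le_succ) ≫ h (m + 1) = h m := fun m =>
      he (k + m) (h m)
    have hk : ∀ m, F.map (homOfLE (k.le_add_right m)) ≫ h m = f := by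
      intro m
      induction m with
      | zero => exact (congrArg (· ≫ f) (F.map_id k)).trans (Category.id_comp f)
      | succ m ih =>
        rw [← hh, ← Category.assoc, ← F.map_comp] at ih
        exact ih
    -- Stage `m` is first pushed to stage `k + m`, where the extension of `f` is available even for
    -- `m < k`.
    obtain ⟨g, hg⟩ := hdesc X (fun m => F.map (homOfLE (m.le_add_left k)) ≫ h m) fun m => by
      rw [← hh m, ← Category.assoc, ← Category.assoc, ← F.map_comp, ← F.map_comp]
      rfl
    exact ⟨g, (hg k).trans (hk k)⟩
  have lift : ∀ {I : Type (max u v w)} [Finite I] (s : I → R) (b : ∀ i, Elt L (s i)),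
      ∀ᶠ m in atTop, ∃ a : ∀ i, Elt (F.obj m) (s i), ∀ i, mapElt (l m) (a i) = b i := by
    intro I _ s b
    have : ∀ i, ∀ᶠ m in atTop, ∃ a : Elt (F.obj m) (s i), mapElt (l m) a = b i := by
      intro i
      obtain ⟨k, a, ha⟩ := hrep (s i) (b i)
      filter_upwards [eventually_ge_atTop k] with m hm
      exact ⟨mapElt (F.map (homOfLE hm)) a, by rw [← mapElt_comp, hl, ha]⟩
    filter_upwards [eventually_all.2 this] with m hm
    choose a ha using hm
    exact ⟨a, ha⟩
  have lift_fin : ∀ {n : ℕ} {s : Fin n → R} (b : Tuple L s),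
      ∀ᶠ m in atTop, ∃ a : Tuple (F.obj m) s, mapTuple (l m) a = b := by
    intro n s b
    filter_upwards [lift (fun i : ULift.{max u v w} (Fin n) => s i.down) fun i => b i.down]
      with m ⟨a, ha⟩
    exact ⟨fun i => a ⟨i⟩, funext fun i => ha ⟨i⟩⟩
  refine ⟨L, η ≫ l 0, ?_, ?_, fun X hX f => ?_⟩
  · refine (hΦ L).2 fun p hp => Set.Subset.antisymm ?_ (p.le L trivial)
    rintro a ⟨b, hb⟩
    -- The tuple and its witnesses come from one stage, and the finitely many equations hold at a
    -- later stage `m`; stage `m + 1` then has witnesses for the lower formula.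
    obtain ⟨k, ⟨a, rfl⟩, b, rfl⟩ := ((lift_fin a).and (lift_fin b)).exists
    have hvan : ∀ e, ∀ᶠ m in atTop, ∀ h : k ≤ m, mapElt (F.map (homOfLE h))
        (∑ i, act _ (a i) (p.upper.freeCoeff i e) + ∑ i, act _ (b i) (p.upper.boundCoeff i e))
          = 0 := by
      intro e
      obtain ⟨m, hkm, hm⟩ := hzero k _
        (∑ i, act _ (a i) (p.upper.freeCoeff i e) + ∑ i, act _ (b i) (p.upper.boundCoeff i e))
        (by
          simp only [mapElt_add, mapElt_sum, mapElt_act]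
          exact hb e)
      filter_upwards [eventually_ge_atTop m] with m' hm' h
      have : homOfLE h = homOfLE hkm ≫ homOfLE hm' := rfl
      rw [this, F.map_comp, mapElt_comp, hm, mapElt_zero]
    obtain ⟨m, hm, hkm⟩ := ((eventually_all.2 hvan).and (eventually_ge_atTop k)).exists
    have hmem : mapTuple (F.map (homOfLE hkm)) a ∈ p.upper.sol (F.obj m) := by
      refine ⟨mapTuple (F.map (homOfLE hkm)) b, fun e => ?_⟩
      have := hm e hkm
      simp only [mapElt_add, mapElt_sum, mapElt_act] at this
      exact this
    have := PPFormula.mapTuple_mem_sol (l (m + 1)) (hsol m p hp _ hmem)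
    rwa [← mapTuple_comp, hl, ← mapTuple_comp, hl] at this
  · intro I _ s b
    obtain ⟨m, b', hb'⟩ := (lift s b).exists
    obtain ⟨B, E, _, _, bs, es, c, h, x, hx, hbx, hX⟩ := hcell m I s b'
    refine ⟨B, E, inferInstance, inferInstance, bs, es, c, h, fun k => mapElt (l m) (x k),
      fun e => ?_, fun i => ?_, fun X hDX z hz => ?_⟩
    · have := congrArg (mapElt (l m)) (hx e)
      simpa only [mapElt_sum, mapElt_act, mapElt_zero] using this
    · rw [← hb', hbx]
      simp only [mapElt_sum, mapElt_act]
    · obtain ⟨f, hf⟩ := hX X hDX z hz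
      obtain ⟨g, rfl⟩ := extend m X hDX f
      exact ⟨g, hf⟩
  · obtain ⟨g, rfl⟩ := hη X f
    obtain ⟨g', rfl⟩ := extend 0 X hX g
    exact ⟨g', Category.assoc _ _ _⟩

/-! ### Cellular covers. -/

/-- Every member of a definable subcategory `D` is a pure epimorphic image of a cellular one. -/
lemma exists_cellular_pureEpi (D : ObjectProperty (RightMod.{w} R)) (hD : IsDefinable D)
    (M : RightMod.{w} R) (hM : D M) :
    ∃ (N : RightMod.{w} R) (f : N ⟶ M), D N ∧ IsCellular D N ∧ IsPureEpi f := by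
  let Z : RightMod.{w} R := ofAction (fun _ => PUnit) (fun _ _ => 0) (fun _ _ => rfl)
    fun _ _ _ _ _ _ => rfl
  -- A pp formula without free variables is just a finite homogeneous system in its bound variables.
  -- The zero solution shows that it holds in every module.
  let J : Type (max u v w) := Σ t : PPFormula (Fin.elim0 : Fin 0 → R),
    {z : Tuple M t.boundSort // ∀ e, ∑ k, act M (z k) (t.boundCoeff k e) = 0}
  obtain ⟨N₀, ι, y, hN₀, hy, huniv⟩ := exists_cellular_extension D Z
    (isCellular_of_forall_eq_zero D Z fun _ _ => rfl) (J := J) (n := fun _ => 0)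
    (fun j => j.1) (fun j => Fin.elim0)
    fun X hX f j => ⟨fun _ => 0, fun e => by simp⟩
  obtain ⟨f₀, -, hf₀⟩ := huniv M (homMk (fun _ => 0) fun _ _ ρ _ => (act_zero ρ).symm)
    (fun j => j.2.1) fun j e => by simpa using j.2.2 e
  obtain ⟨N, l, hDN, hN, hext⟩ := exists_cellular_weak_reflection D hD N₀ hN₀
  obtain ⟨f, rfl⟩ := hext M hM f₀
  obtain ⟨K, i, hi, hK⟩ := exists_submodule N (fun r => (mapHom f r).ker) fun r s ρ a ha => by
    change mapElt f _ = 0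
    rw [mapElt_act, show mapElt f a = 0 from ha, act_zero]
  refine ⟨N, f, hDN, hN, fun r b => ?_, K, i, fun n s d => ?_, hK⟩
  -- One unknown and no equations: a free generator mapped to `b`.
  · let j : J := ⟨⟨1, fun _ => r, 0, Fin.elim0, fun i => i.elim0, fun _ e => e.elim0⟩,
      fun _ => b, fun e => e.elim0⟩
    exact ⟨mapElt l (y j 0), hf₀ j 0⟩
  · refine Set.Subset.antisymm (fun ψ hψ => ?_) fun ψ hψ => PPFormula.mapTuple_mem_sol i hψ
    obtain ⟨x, hx⟩ := hψ
    have hid : ∀ r (c : Elt K r), mapElt f (mapElt i c) = 0 := fun r c => (hK r _).2 ⟨c, rfl⟩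
    -- As `f` kills `d`, the image `f x` solves the homogeneous part of `ψ`. Subtracting from `x`
    -- the generic solution over `f x` keeps the equations with parameters `d` and moves the
    -- witnesses into the kernel.
    let j : J := ⟨⟨ψ.numBound, ψ.boundSort, ψ.numEq, ψ.eqSort, fun i => i.elim0, ψ.boundCoeff⟩,
      mapTuple f x, fun e => by
        have := congrArg (mapElt f) (hx e)
        simp only [mapElt_add, mapElt_sum, mapElt_act, mapElt_zero] at this
        refine Eq.trans ?_ this
        refine (zero_add _).symm.trans (congrArg₂ _ (Finset.sum_eq_zero fun k _ => ?_).symm rfl)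
        rw [show mapElt f (mapTuple i d k) = 0 from hid _ _, act_zero]⟩
    have hyj : ∀ e, ∑ k, act N (mapElt l (y j k)) (ψ.boundCoeff k e) = 0 := by
      intro e
      have := congrArg (mapElt l) (hy j e)
      simp only [mapElt_sum, mapElt_act, mapElt_zero, Finset.univ_eq_empty,
        Finset.sum_empty, zero_add] at this
      exact this
    have hker : ∀ k, ∃ c : Elt K (ψ.boundSort k), mapElt i c = x k - mapElt l (y j k) := by
      intro k
      refine (hK _ _).1 ?_
      change mapElt f _ = 0
      rw [mapElt_sub, sub_eq_zero]
      exact (hf₀ j k).symm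
    choose c hc using hker
    refine ⟨c, fun e => hi _ ?_⟩
    have hsub : ∑ k, act N (x k - mapElt l (y j k)) (ψ.boundCoeff k e) =
        ∑ k, act N (x k) (ψ.boundCoeff k e) := by
      simp only [act_sub, Finset.sum_sub_distrib]
      exact (congrArg _ (hyj e)).trans (sub_zero _)
    simp only [mapElt_add, mapElt_sum, mapElt_act, mapElt_zero, hc]
    exact (congrArg _ hsub).trans (hx e)

/-! ### Formulas from linear systems, and lifting of solutions. -/

/-- The linear combinations `h` of the solutions of a finite system `c` of linear equations form
the solution set of a pp formula. -/
lemma exists_ppFormula {B E : Type*} [Fintype B] [Fintype E] {bs : B → R} {es : E → R}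
    (c : ∀ k e, es e ⟶ bs k) {n : ℕ} {s : Fin n → R} (h : ∀ k i, s i ⟶ bs k) :
    ∃ φ : PPFormula s, ∀ (X : RightMod.{w} R) (a : Tuple X s), a ∈ φ.sol X ↔
      ∃ z : ∀ k, Elt X (bs k), (∀ e, ∑ k, act X (z k) (c k e) = 0) ∧
        ∀ i, a i = ∑ k, act X (z k) (h k i) := by
  classical
  let β := (Fintype.equivFin B).symm
  let ε := (Fintype.equivFin (E ⊕ Fin n)).symm
  let es' : E ⊕ Fin n → R := Sum.elim es s
  let free : ∀ (i : Fin n) (e : E ⊕ Fin n), es' e ⟶ s i := fun i e =>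
    match e with
    | .inl e => 0
    -- Minus the identity matrix, turning `a i = ∑ k, z k · h k i` into a homogeneous equation;
    -- `eqToHom` only matches the sorts.
    | .inr i' => if hi : i' = i then -eqToHom (congrArg s hi) else 0
  let bound : ∀ (k : B) (e : E ⊕ Fin n), es' e ⟶ bs k := fun k e =>
    match e with
    | .inl e => c k e
    | .inr i => h k i
  have hfree : ∀ (X : RightMod.{w} R) (a : Tuple X s) (i : Fin n),
      ∑ i', act X (a i') (free i' (.inr i)) = -a i := by
    intro X a i
    rw [Finset.sum_eq_single i]
    · change act X (a i) (if hi : i = i then -eqToHom (congrArg s hi) else 0) = -a i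
      rw [dif_pos rfl, act_hom_neg, eqToHom_refl, act_id]
    · intro i' _ hi'
      change act X (a i') (if hi : i = i' then -eqToHom (congrArg s hi) else 0) = 0
      rw [dif_neg hi'.symm, act_hom_zero]
    · exact fun hi => (hi (Finset.mem_univ i)).elim
  have hsys : ∀ (X : RightMod.{w} R) (a : Tuple X s) (z : ∀ k, Elt X (bs k)),
      (∀ e, ∑ i, act X (a i) (free i e) + ∑ k, act X (z k) (bound k e) = 0) ↔
        (∀ e, ∑ k, act X (z k) (c k e) = 0) ∧ ∀ i, a i = ∑ k, act X (z k) (h k i) := by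
    intro X a z
    rw [Sum.forall]
    refine and_congr (forall_congr' fun e => ?_) (forall_congr' fun i => ?_)
    · rw [Finset.sum_eq_zero fun i _ => act_hom_zero (a i), zero_add]
      rfl
    · rw [hfree]
      exact neg_add_eq_zero (a := a i)
  refine ⟨⟨_, fun k => bs (β k), _, fun e => es' (ε e), fun i e => free i (ε e),
    fun k e => bound (β k) (ε e)⟩, fun X a => ?_⟩
  simp only [← hsys]
  constructor
  · rintro ⟨z, hz⟩
    obtain ⟨z, rfl⟩ := (β.piCongrLeft fun k => Elt X (bs k)).symm.surjective z
    refine ⟨z, fun e => ?_⟩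
    obtain ⟨e, rfl⟩ := ε.surjective e
    refine Eq.trans (congrArg _ ?_) (hz e)
    exact (β.sum_comp fun k => act X (z k) (bound k (ε e))).symm
  · rintro ⟨z, hz⟩
    refine ⟨fun k => z (β k), fun e => Eq.trans ?_ (hz (ε e))⟩
    exact congrArg _ (β.sum_comp fun k => act X (z k) (bound k (ε e)))

/-- Solutions of pp formulas lift along pure epimorphisms. -/
lemma IsPureEpi.exists_mem_sol {N M : RightMod.{w} R} {f : N ⟶ M} (hf : IsPureEpi f) {n : ℕ}
    {s : Fin n → R} {φ : PPFormula s} {a : Tuple M s} (ha : a ∈ φ.sol M) :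
    ∃ b ∈ φ.sol N, mapTuple f b = a := by
  obtain ⟨hsurj, K, i, hi, hK⟩ := hf
  obtain ⟨b, hb⟩ := ha
  choose a' ha' using fun i => hsurj _ (a i)
  choose b' hb' using fun i => hsurj _ (b i)
  have hker : ∀ e, ∃ d : Elt K (φ.eqSort e), mapElt i d =
      ∑ i, act N (a' i) (φ.freeCoeff i e) + ∑ k, act N (b' k) (φ.boundCoeff k e) := by
    intro e
    refine (hK _ _).1 ?_
    simp only [mapElt_add, mapElt_sum, mapElt_act]
    simp only at ha' hb'
    simp only [ha', hb', hb]
  choose d hd using hker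
  let h : ∀ (k : Fin n ⊕ Fin φ.numBound) (e : Fin φ.numEq),
      φ.eqSort e ⟶ Sum.elim s φ.boundSort k :=
    Sum.rec (fun i e => φ.freeCoeff i e) fun k e => φ.boundCoeff k e
  have hsum : ∀ (X : RightMod.{w} R) (z : ∀ k, Elt X (Sum.elim s φ.boundSort k)) e,
      ∑ k, act X (z k) (h k e) = ∑ i, act X (z (.inl i)) (φ.freeCoeff i e) +
        ∑ k, act X (z (.inr k)) (φ.boundCoeff k e) := fun X z e => Fintype.sum_sum_type _
  -- `ψ` says that the system of `φ` is solvable with its argument as right-hand side. The errors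
  -- `d` of arbitrary lifts satisfy it in `N`, hence by purity in `K`; subtracting that solution
  -- corrects the lifts without changing their images.
  obtain ⟨ψ, hψ⟩ := exists_ppFormula.{w} (E := Empty) (es := Empty.elim) (fun _ e => e.elim) h
  let ab : ∀ k, Elt N (Sum.elim s φ.boundSort k) := Sum.rec a' b'
  have hd' : mapTuple i d ∈ ψ.sol N :=
    (hψ N _).2 ⟨ab, fun e => e.elim, fun e => (hd e).trans (hsum N ab e).symm⟩
  have hdK : d ∈ ψ.sol K := by
    change ψ ∈ ppType K d
    rw [← hi]
    exact hd'
  obtain ⟨p, q, hpq⟩ : ∃ (p : Tuple K s) (q : Tuple K φ.boundSort), ∀ e,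
      d e = ∑ i, act K (p i) (φ.freeCoeff i e) + ∑ k, act K (q k) (φ.boundCoeff k e) := by
    obtain ⟨z, -, hz⟩ := (hψ K d).1 hdK
    exact ⟨fun k => z (.inl k), fun k => z (.inr k), fun e => (hz e).trans (hsum K z e)⟩
  refine ⟨fun k => a' k - mapElt i (p k),
    ⟨fun k => b' k - mapElt i (q k), fun e => ?_⟩, funext fun k => ?_⟩
  · have := hd e
    rw [hpq] at this
    simp only [mapElt_add, mapElt_sum, mapElt_act] at this
    simp only [act_sub, Finset.sum_sub_distrib]
    rw [sub_add_sub_comm, sub_eq_zero]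
    exact this.symm
  · change mapElt f _ = _
    rw [mapElt_sub]
    exact (congrArg₂ _ (ha' k) ((hK _ _).2 ⟨_, rfl⟩)).trans (sub_zero _)

end AtomicModules

/-! ### The equivalence. -/

open AtomicModules in
theorem corollary4p20 {R : Type u} [Category.{v} R] [Preadditive R]
    (D : ObjectProperty (AtomicModules.RightMod.{w} R)) (hD : AtomicModules.IsDefinable D)
    (M : AtomicModules.RightMod.{w} R) (hM : D M) :
    AtomicModules.IsStrictlyAtomic D M ↔ AtomicModules.IsLocallyPureProjective D M := by
  constructor
  · rintro ⟨hat, hstrict⟩ N hN f hf n s a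
    obtain ⟨φ, hφ⟩ := hat n s a
    have ha : a ∈ φ.sol M := by
      change φ ∈ ppType M a
      rw [hφ]
      exact fun _ _ => subset_rfl
    obtain ⟨b, hb, rfl⟩ := hf.exists_mem_sol ha
    obtain ⟨g, hg⟩ := hstrict n s _ φ hφ N hN b hb
    exact ⟨g, by rw [hg]⟩
  · intro hM'
    obtain ⟨N, f, hDN, hN, hf⟩ := exists_cellular_pureEpi D hD M hM
    have key : ∀ (n : ℕ) (s : Fin n → R) (a : Tuple M s), ∃ φ : PPFormula s, a ∈ φ.sol M ∧
        ∀ X, D X → ∀ b ∈ φ.sol X, ∃ g : M ⟶ X, mapTuple g a = b := by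
      intro n s a
      obtain ⟨g, hg⟩ := hM' N hDN f hf n s a
      obtain ⟨B, E, _, _, bs, es, c, h, x, hx, hax, hext⟩ := hN (ULift.{max u v w} (Fin n))
        (fun i => s i.down) fun i => mapTuple g a i.down
      obtain ⟨φ, hφ⟩ := exists_ppFormula c fun k i => h k ⟨i⟩
      refine ⟨φ, ?_, fun X hX b hb => ?_⟩
      · rw [← hg]
        exact PPFormula.mapTuple_mem_sol f ((hφ N _).2 ⟨x, hx, fun i => hax ⟨i⟩⟩)
      · obtain ⟨z, hz, hbz⟩ := (hφ X b).1 hb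
        obtain ⟨q, hq⟩ := hext X hX z hz
        refine ⟨g ≫ q, funext fun i => ?_⟩
        have := congrArg (mapElt q) (hax ⟨i⟩)
        simp only [mapElt_sum, mapElt_act, hq] at this
        exact this.trans (hbz i).symm
    refine ⟨fun n s a => ?_, fun n s a φ' hφ' X hX b hb => ?_⟩
    · obtain ⟨φ, ha, hφ⟩ := key n s a
      refine ⟨φ, Set.Subset.antisymm (fun ψ hψ X hX b hb => ?_) fun ψ hψ => hψ M hM ha⟩
      obtain ⟨g, rfl⟩ := hφ X hX b hb
      exact PPFormula.mapTuple_mem_sol g hψ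
    · obtain ⟨φ, ha, hφ⟩ := key n s a
      -- Strictness is required for every generator `φ'`, and each one implies `φ` on `D`.
      have hmem : φ ∈ ppGenerated D φ' := hφ' ▸ ha
      exact hφ X hX b (hmem X hX hb)
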